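/- There exists an absolute constant $C_2 > 1$ such that the following holds. Let $d_A \ge 2$ and $d_B \ge 1$ be integers and $d = d_A d_B$, and identify $\mathbb{C}^d$ with $\mathbb{C}^{d_A} \otimes \mathbb{C}^{d_B}$, the tensor factors being called $A$ and $B$. For a $d \times d$ unitary matrix $U$ and $X \in \mathbb{C}^{d \times d}$ put $\Phi_U(X) = \operatorname{tr}_B(U X U^\dagger) \in \mathbb{C}^{d_A \times d_A}$, where $\operatorname{tr}_B$ is the partial trace over $B$, and let $\|M\|_2 = \sqrt{\operatorname{tr}(M^\dagger M)}$ be the Hilbert--Schmidt (Schatten $2$-) norm. Then for all quantum states $\rho, \sigma \in \mathbb{C}^{d \times d}$ (positive semidefinite matrices of trace $1$), $$\Pr_{U \sim U(d)}\left[\, \|\Phi_U(\rho) - \Phi_U(\sigma)\|_2 \;\ge\; \frac12 \sqrt{\frac{d_A}{d}} \cdot \|\rho - \sigma\|_2 \right] \;\ge\; \frac{1}{C_2},$$ where $U$ is distributed according to the Haar probability measure on the unitary group $U(d)$. -/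

import Mathlib

open scoped Matrix ComplexOrder

noncomputable section

namespace QCompress

/-- A quantum state (density matrix): a positive semidefinite complex matrix of trace one. -/
def IsState {n : Type*} [Fintype n] (ρ : Matrix n n ℂ) : Prop :=
  ρ.PosSemidef ∧ ρ.trace = 1

/-- The Hilbert-Schmidt (Schatten 2-) norm, `‖M‖₂ = √(tr (M† M))`. -/
def hsNorm {n : Type*} [Fintype n] (M : Matrix n n ℂ) : ℝ :=
  Real.sqrt (Mᴴ * M).trace.re

/-- The partial trace over the second tensor factor. A matrix indexed by `a × b` is an operator
on `ℂ^a ⊗ ℂ^b`. -/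
def partialTraceB {a b : Type*} [Fintype b] (M : Matrix (a × b) (a × b) ℂ) : Matrix a a ℂ :=
  Matrix.of fun i j => ∑ k, M (i, k) (j, k)

/-- The compression channel `Φ_U(X) = tr_B (U X U†)`. -/
def compress {a b : Type*} [Fintype a] [DecidableEq a] [Fintype b] [DecidableEq b]
    (U : Matrix.unitaryGroup (a × b) ℂ) (X : Matrix (a × b) (a × b) ℂ) : Matrix a a ℂ :=
  partialTraceB ((U : Matrix (a × b) (a × b) ℂ) * X * (U : Matrix (a × b) (a × b) ℂ)ᴴ)

section Haar

variable (n : Type*) [Fintype n] [DecidableEq n]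

/-- The unitary group is compact in the topology inherited from the matrices. -/
instance instCompactSpaceUnitaryGroup : CompactSpace (Matrix.unitaryGroup n ℂ) := by
  refine isCompact_iff_compactSpace (s := (Matrix.unitaryGroup n ℂ : Set (Matrix n n ℂ))).mp ?_
  have hK : IsCompact (Set.pi Set.univ fun _ : n => Set.pi Set.univ
      fun _ : n => Metric.closedBall (0 : ℂ) 1) :=
    isCompact_univ_pi fun _ => isCompact_univ_pi fun _ => isCompact_closedBall _ _
  refine IsCompact.of_isClosed_subset (X := Matrix n n ℂ) hK ?_ ?_
  · have h : (Matrix.unitaryGroup n ℂ : Set (Matrix n n ℂ)) =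
        {U : Matrix n n ℂ | U * star U = 1} := by
      ext U
      exact Matrix.mem_unitaryGroup_iff
    rw [h]
    exact isClosed_eq (by fun_prop) continuous_const
  · intro U hU i _ j _
    simpa using entry_norm_bound_of_unitary hU i j

instance instMeasurableSpaceUnitaryGroup : MeasurableSpace (Matrix.unitaryGroup n ℂ) :=
  borel _

instance instBorelSpaceUnitaryGroup : BorelSpace (Matrix.unitaryGroup n ℂ) := ⟨rfl⟩

/-- The Haar probability measure on the unitary group: Mathlib's Haar measure, normalized to give
the whole group mass one. -/
def haarUnitary : MeasureTheory.Measure (Matrix.unitaryGroup n ℂ) :=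
  MeasureTheory.Measure.haarMeasure ⊤

instance instIsProbabilityMeasureHaarUnitary :
    MeasureTheory.IsProbabilityMeasure (haarUnitary n) :=
  ⟨by
    simpa [haarUnitary] using MeasureTheory.Measure.haarMeasure_self
      (G := Matrix.unitaryGroup n ℂ) (K₀ := ⊤)⟩

instance instIsHaarMeasureHaarUnitary :
    (haarUnitary n).IsHaarMeasure := by
  unfold haarUnitary
  infer_instance

end Haar

end QCompress

end

noncomputable section

namespace QCompress

open MeasureTheory

/-! ### Fourth moments of sums with sign symmetry or exchangeability. -/

section FourthMoments

variable {Ω : Type*} [TopologicalSpace Ω] [CompactSpace Ω] [T2Space Ω] [MeasurableSpace Ω] [BorelSpace Ω]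

/-! Put `D = ρ - σ`, Hermitian and traceless, and `X = ‖tr_B (U D U†)‖₂²`. The event is `X ≥ ‖D‖₂² /
(4 d_B)`, so by Paley–Zygmund (`inv_le_measureReal_ge`) it suffices that `E X ≥ ‖D‖₂² / (2 d_B)` and
`E X² ≤ K (‖D‖₂² / d_B)²` with `K` absolute. No Weingarten calculus is used, only invariance of Haar
measure under permutations, diagonal phases and two-coordinate Hadamard rotations.

Mean: these symmetries determine the second moment of an off-diagonal entry of `U D U†` exactly
(`integral_normSq_offDiag`). The off-diagonal entries of the partial trace alone then suffice
(`le_integral_hsNorm_compress_sq`).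

Second moment: each entry of the partial trace is `tr (U D U† G)`. For Hermitian `G`, diagonalising
`D` and `G` turns this into `∑ λ_a μ_b |U_ba|²`. Its fourth moment is bounded by applying an
inequality for exchangeable families (`integral_exchangeable_sum_pow_four_le`) to the rows and then
to the columns of `U`, starting from `E |U_ba|⁸ = O(d⁻⁴)` (`integral_normSq_pow_four_le`). -/

theorem integrable_of_continuous (P : Measure Ω) [IsFiniteMeasure P] {f : Ω → ℝ}
    (hf : Continuous f) : Integrable f P :=
  integrableOn_univ.mp (hf.continuousOn.integrableOn_compact isCompact_univ)

theorem sq_integral_mul_le (P : Measure Ω) [IsFiniteMeasure P] {f g : Ω → ℝ}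
    (hf : Continuous f) (hg : Continuous g) :
    (∫ ω, f ω * g ω ∂P) ^ 2 ≤ (∫ ω, f ω ^ 2 ∂P) * ∫ ω, g ω ^ 2 ∂P := by
  have key : ∀ t : ℝ, 0 ≤ (∫ ω, g ω ^ 2 ∂P) * (t * t) + (-2 * ∫ ω, f ω * g ω ∂P) * t
      + ∫ ω, f ω ^ 2 ∂P := by
    intro t
    have h : 0 ≤ ∫ ω, (f ω - t * g ω) ^ 2 ∂P := integral_nonneg fun ω => sq_nonneg _
    have h2 : ∫ ω, (f ω - t * g ω) ^ 2 ∂P =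
        ∫ ω, (f ω ^ 2 + (-2 * t) * (f ω * g ω)) + t ^ 2 * g ω ^ 2 ∂P := by
      congr 1; ext ω; ring
    rw [h2, integral_add (integrable_of_continuous P (by fun_prop))
      (integrable_of_continuous P (by fun_prop)),
      integral_add (integrable_of_continuous P (by fun_prop))
      (integrable_of_continuous P (by fun_prop)), integral_const_mul, integral_const_mul] at h
    linarith
  have := discrim_le_zero key
  unfold discrim at this
  nlinarith

/-- A Khintchine inequality in which random signs are replaced by measure-preserving maps flipping
one `y i` at a time. Adding one term to a partial sum with `V = ∑ w²` costs `w⁴ m + 6 w² · 3 V m`;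
the constant 9 satisfies `6 √9 = 2 · 9`, so the induction closes. -/
theorem integral_sum_mul_pow_four_le (P : Measure Ω) [IsProbabilityMeasure P] {ι : Type*}
    [DecidableEq ι] (w : ι → ℝ) (y : ι → Ω → ℝ) (hy : ∀ i, Continuous (y i)) {m : ℝ} (hm0 : 0 ≤ m)
    (s : Finset ι) (hm : ∀ i ∈ s, ∫ ω, y i ω ^ 4 ∂P ≤ m)
    (hT : ∀ i ∈ s, ∃ T : Ω → Ω, (∀ f : Ω → ℝ, ∫ ω, f (T ω) ∂P = ∫ ω, f ω ∂P) ∧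
      (∀ ω, y i (T ω) = -y i ω) ∧ ∀ j ∈ s, j ≠ i → ∀ ω, y j (T ω) = y j ω) :
    ∫ ω, (∑ i ∈ s, w i * y i ω) ^ 4 ∂P ≤ 9 * (∑ i ∈ s, w i ^ 2) ^ 2 * m := by
  induction s using Finset.induction_on with
  | empty => simp
  | insert i s his ih =>
    have ih' := ih (fun j hj => hm j (Finset.mem_insert_of_mem hj)) (by
      intro j hj
      obtain ⟨T, h1, h2, h3⟩ := hT j (Finset.mem_insert_of_mem hj)
      exact ⟨T, h1, h2, fun k hk => h3 k (Finset.mem_insert_of_mem hk)⟩)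
    obtain ⟨T, hTi, hTy, hTs⟩ := hT i (Finset.mem_insert_self _ _)
    have hmi := hm i (Finset.mem_insert_self _ _)
    set A : Ω → ℝ := fun ω => ∑ j ∈ s, w j * y j ω with hA
    have hAc : Continuous A := by
      rw [hA]; exact continuous_finsetSum _ fun j _ => continuous_const.mul (hy j)
    have hyc := hy i
    have hAT : ∀ ω, A (T ω) = A ω := fun ω => Finset.sum_congr rfl fun j hj => by
      rw [hTs j (Finset.mem_insert_of_mem hj) (fun h => his (h ▸ hj))]
    set V := ∑ j ∈ s, w j ^ 2
    have hV : 0 ≤ V := Finset.sum_nonneg fun j _ => sq_nonneg _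
    -- `T` flips `y i` and fixes `A`, so the terms of odd degree in `y i` integrate to zero.
    have odd : ∀ g : ℝ → ℝ → ℝ, (∀ a b, g (-a) b = - g a b) → ∫ ω, g (y i ω) (A ω) ∂P = 0 := by
      intro g hg
      have h := hTi fun ω => g (y i ω) (A ω)
      simp only [hTy, hAT, hg, integral_neg] at h
      linarith
    have o1 := odd (fun a b => a ^ 3 * b) (by intros; ring)
    have o2 := odd (fun a b => a * b ^ 3) (by intros; ring)
    have cs := sq_integral_mul_le P (f := fun ω => y i ω ^ 2) (g := fun ω => A ω ^ 2)
      (by fun_prop) (by fun_prop)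
    simp only [← pow_mul] at cs
    norm_num at cs
    have hQ : ∫ ω, y i ω ^ 2 * A ω ^ 2 ∂P ≤ 3 * V * m := by
      have h4 : 0 ≤ ∫ ω, A ω ^ 4 ∂P := integral_nonneg fun ω => by positivity
      have h5 : 0 ≤ ∫ ω, y i ω ^ 4 ∂P := integral_nonneg fun ω => by positivity
      refine abs_le_of_sq_le_sq' ?_ (by positivity) |>.2
      calc _ ≤ _ := cs
        _ ≤ m * (9 * V ^ 2 * m) := by gcongr
        _ = _ := by ring
    have expand : ∫ ω, (∑ j ∈ insert i s, w j * y j ω) ^ 4 ∂P =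
        w i ^ 4 * ∫ ω, y i ω ^ 4 ∂P + 6 * w i ^ 2 * ∫ ω, y i ω ^ 2 * A ω ^ 2 ∂P
          + ∫ ω, A ω ^ 4 ∂P := by
      have : ∀ ω, (∑ j ∈ insert i s, w j * y j ω) ^ 4 =
          (w i ^ 4 * y i ω ^ 4 + 6 * w i ^ 2 * (y i ω ^ 2 * A ω ^ 2) + A ω ^ 4)
          + (4 * w i ^ 3 * (y i ω ^ 3 * A ω) + 4 * w i * (y i ω * A ω ^ 3)) := by
        intro ω
        rw [Finset.sum_insert his]
        change (w i * y i ω + A ω) ^ 4 = _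
        ring
      simp only [this]
      rw [integral_add, integral_add, integral_add, integral_add, integral_const_mul,
        integral_const_mul, integral_const_mul, integral_const_mul, o1, o2]
      · ring
      all_goals exact integrable_of_continuous P (by fun_prop)
    rw [expand, Finset.sum_insert his]
    change _ ≤ 9 * (w i ^ 2 + V) ^ 2 * m
    have e1 : w i ^ 4 * ∫ ω, y i ω ^ 4 ∂P ≤ w i ^ 4 * m := by gcongr
    have e2 : 6 * w i ^ 2 * ∫ ω, y i ω ^ 2 * A ω ^ 2 ∂P ≤ 6 * w i ^ 2 * (3 * V * m) := by gcongr
    have e3 : 0 ≤ w i ^ 4 * m := by positivity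
    linear_combination e1 + e2 + ih' + 8 * e3

theorem sum_filter_lt_involution {ι : Type*} [Fintype ι] [LinearOrder ι] {σ : ι → ι}
    (hσ : Function.Involutive σ) (g : ι → ℝ) :
    ∑ b with b < σ b, (g b + g (σ b)) + ∑ b with σ b = b, g b = ∑ b, g b := by
  have h1 : ∑ b with b < σ b, g (σ b) = ∑ b with σ b < b, g b := by
    refine Finset.sum_bij' (fun b _ => σ b) (fun b _ => σ b) ?_ ?_ ?_ ?_ ?_ <;>
      simp [hσ _]
  have h2 := Finset.sum_filter_add_sum_filter_not Finset.univ (fun b => b < σ b) g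
  have h3 := Finset.sum_filter_add_sum_filter_not (Finset.univ.filter fun b => ¬ b < σ b)
    (fun b => σ b = b) g
  rw [Finset.filter_filter, Finset.filter_filter] at h3
  have e1 : (Finset.univ.filter fun b => ¬ b < σ b ∧ σ b = b) =
      Finset.univ.filter fun b => σ b = b := by
    ext b; simp only [Finset.mem_filter]; constructor
    · tauto
    · rintro ⟨h, h'⟩; exact ⟨h, by rw [h']; exact lt_irrefl _, h'⟩
  have e2 : (Finset.univ.filter fun b => ¬ b < σ b ∧ ¬ σ b = b) =
      Finset.univ.filter fun b => σ b < b := by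
    ext b; simp only [Finset.mem_filter, not_lt]; constructor
    · rintro ⟨h, h', h''⟩; exact ⟨h, lt_of_le_of_ne h' h''⟩
    · rintro ⟨h, h'⟩; exact ⟨h, h'.le, h'.ne⟩
  rw [e1, e2] at h3
  rw [Finset.sum_add_distrib, h1]
  linarith

theorem integral_sub_pow_four_le (P : Measure Ω) [IsProbabilityMeasure P] {f g : Ω → ℝ}
    (hf : Continuous f) (hg : Continuous g) {m : ℝ} (hfm : ∫ ω, f ω ^ 4 ∂P ≤ m)
    (hgm : ∫ ω, g ω ^ 4 ∂P ≤ m) : ∫ ω, (f ω - g ω) ^ 4 ∂P ≤ 16 * m := by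
  have h : ∫ ω, (f ω - g ω) ^ 4 ∂P ≤ ∫ ω, 8 * f ω ^ 4 + 8 * g ω ^ 4 ∂P := by
    refine integral_mono (integrable_of_continuous P (by fun_prop))
      (integrable_of_continuous P (by fun_prop)) fun ω => ?_
    have h1 : (f ω - g ω) ^ 2 ≤ 2 * (f ω ^ 2 + g ω ^ 2) := by nlinarith [sq_nonneg (f ω + g ω)]
    have h2 : ((f ω - g ω) ^ 2) ^ 2 ≤ (2 * (f ω ^ 2 + g ω ^ 2)) ^ 2 := by gcongr
    change (f ω - g ω) ^ 4 ≤ 8 * f ω ^ 4 + 8 * g ω ^ 4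
    nlinarith [sq_nonneg (f ω ^ 2 - g ω ^ 2)]
  rw [integral_add (integrable_of_continuous P (by fun_prop))
      (integrable_of_continuous P (by fun_prop)), integral_const_mul, integral_const_mul] at h
  linarith

/-- Differences along the disjoint 2-cycles of `σ` can be sign-flipped independently by transposing
their endpoints, which is the symmetry required by `integral_sum_mul_pow_four_le`. -/
theorem integral_involution_sum_pow_four_le (P : Measure Ω) [IsProbabilityMeasure P] {ι : Type*}
    [Fintype ι] [LinearOrder ι] (μ : ι → ℝ) (x : ι → Ω → ℝ)
    (hx : ∀ i, Continuous (x i)) {m : ℝ} (hm : ∀ i, ∫ ω, x i ω ^ 4 ∂P ≤ m)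
    (hT : ∀ p q, ∃ T : Ω → Ω, (∀ f : Ω → ℝ, ∫ ω, f (T ω) ∂P = ∫ ω, f ω ∂P) ∧
      ∀ b ω, x b (T ω) = x (Equiv.swap p q b) ω) {σ : ι → ι} (hσ : Function.Involutive σ) :
    ∫ ω, (∑ b, μ b * (x b ω - x (σ b) ω)) ^ 4 ∂P ≤ 576 * (∑ b, μ b ^ 2) ^ 2 * m := by
  rcases isEmpty_or_nonempty ι with hι | ⟨⟨i₀⟩⟩
  · simp
  have hm0 : 0 ≤ m := le_trans (integral_nonneg fun ω => by positivity) (hm i₀)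
  -- Fixed points of `σ` contribute zero; each 2-cycle is counted once, at its smaller element.
  have hsum : ∀ ω, ∑ b, μ b * (x b ω - x (σ b) ω) =
      ∑ b with b < σ b, (μ b - μ (σ b)) * (x b ω - x (σ b) ω) := by
    intro ω
    rw [← sum_filter_lt_involution hσ,
      Finset.sum_eq_zero (s := Finset.univ.filter fun b => σ b = b), add_zero]
    · refine Finset.sum_congr rfl fun b _ => ?_
      rw [hσ]; ring
    · intro b hb
      rw [(Finset.mem_filter.mp hb).2]; ring
  have hw : ∑ b with b < σ b, (μ b - μ (σ b)) ^ 2 ≤ 2 * ∑ b, μ b ^ 2 := by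
    rw [← sum_filter_lt_involution hσ (fun b => μ b ^ 2), mul_add, Finset.mul_sum]
    have h0 : 0 ≤ ∑ b with σ b = b, μ b ^ 2 := Finset.sum_nonneg fun b _ => sq_nonneg _
    have h1 : ∑ b with b < σ b, (μ b - μ (σ b)) ^ 2 ≤
        ∑ b with b < σ b, 2 * (μ b ^ 2 + μ (σ b) ^ 2) :=
      Finset.sum_le_sum fun b _ => by nlinarith [sq_nonneg (μ b + μ (σ b))]
    linarith
  simp only [hsum]
  have main := integral_sum_mul_pow_four_le P (fun b => μ b - μ (σ b))
    (fun b ω => x b ω - x (σ b) ω) (fun b => (hx _).sub (hx _)) (m := 16 * m) (by positivity)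
    (Finset.univ.filter fun b => b < σ b)
    (fun b _ => integral_sub_pow_four_le P (hx _) (hx _) (hm _) (hm _)) (by
      intro b hb
      obtain ⟨T, h1, h2⟩ := hT b (σ b)
      refine ⟨T, h1, fun ω => by simp [h2], fun c hc hcb ω => ?_⟩
      have hb' := (Finset.mem_filter.mp hb).2
      have hc' := (Finset.mem_filter.mp hc).2
      have n1 : c ≠ σ b := by
        rintro rfl
        rw [hσ] at hc'
        exact lt_asymm hb' hc'
      have n2 : σ c ≠ b := fun h => n1 (by rw [← h, hσ])
      have n3 : σ c ≠ σ b := fun h => hcb (hσ.injective h)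
      rw [h2, h2, Equiv.swap_apply_of_ne_of_ne hcb n1, Equiv.swap_apply_of_ne_of_ne n2 n3])
  refine main.trans ?_
  have h0 : 0 ≤ ∑ b with b < σ b, (μ b - μ (σ b)) ^ 2 := Finset.sum_nonneg fun b _ => sq_nonneg _
  -- `576 = 9 · 2² · 16`: the Khintchine constant, the weights `μ b - μ (σ b)`, and the differences
  -- of the `x b`.
  calc _ ≤ 9 * (2 * ∑ b, μ b ^ 2) ^ 2 * (16 * m) := by gcongr
    _ = _ := by ring

/-- Fourth moment bound for linear statistics of an exchangeable family with centred weights. -/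
theorem integral_exchangeable_sum_pow_four_le (P : Measure Ω) [IsProbabilityMeasure P] {ι : Type*}
    [Fintype ι] [DecidableEq ι] (μ : ι → ℝ) (hμ : ∑ i, μ i = 0) (x : ι → Ω → ℝ)
    (hx : ∀ i, Continuous (x i)) {m : ℝ} (hm : ∀ i, ∫ ω, x i ω ^ 4 ∂P ≤ m)
    (hT : ∀ p q, ∃ T : Ω → Ω, (∀ f : Ω → ℝ, ∫ ω, f (T ω) ∂P = ∫ ω, f ω ∂P) ∧
      ∀ b ω, x b (T ω) = x (Equiv.swap p q b) ω) :
    ∫ ω, (∑ b, μ b * x b ω) ^ 4 ∂P ≤ 576 * (∑ b, μ b ^ 2) ^ 2 * m := by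
  rcases isEmpty_or_nonempty ι with hι | hι
  · simp
  have : NeZero (Fintype.card ι) := ⟨Fintype.card_ne_zero⟩
  let e := Fintype.equivFin ι
  -- A cyclic group structure supplies the involutions `b ↦ c - b`. For fixed `b` the point `c - b`
  -- runs over all of `ι`, so averaging over `c` replaces `x (c - b)` by a quantity independent of
  -- `b`, which the centred weights annihilate.
  let _ : AddCommGroup ι := e.addCommGroup
  let _ : LinearOrder ι := LinearOrder.lift' e e.injective
  set N : ℝ := (Fintype.card ι : ℝ) with hN
  have hNpos : 0 < N := by rw [hN]; exact_mod_cast Fintype.card_pos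
  have avg : ∀ ω, ∑ b, μ b * x b ω =
      ∑ c : ι, N⁻¹ * ∑ b, μ b * (x b ω - x (c - b) ω) := by
    intro ω
    have h : ∑ c : ι, ∑ b, μ b * x (c - b) ω = 0 := by
      rw [Finset.sum_comm]
      have : ∀ b, ∑ c, μ b * x (c - b) ω = μ b * ∑ c, x c ω := fun b => by
        rw [← Finset.mul_sum]
        congr 1
        exact (Equiv.subRight b).sum_comp fun c => x c ω
      simp only [this, ← Finset.sum_mul, hμ, zero_mul]
    rw [← Finset.mul_sum]
    simp only [mul_sub, Finset.sum_sub_distrib]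
    rw [h, mul_zero, sub_zero, Finset.sum_const, Finset.card_univ, nsmul_eq_mul, ← hN]
    field_simp
  have jensen : ∀ ω, (∑ b, μ b * x b ω) ^ 4 ≤
      ∑ c : ι, N⁻¹ * (∑ b, μ b * (x b ω - x (c - b) ω)) ^ 4 := by
    intro ω
    rw [avg]
    refine Real.pow_arith_mean_le_arith_mean_pow_of_even _ _ _ (fun _ _ => by positivity) ?_
      (by decide)
    rw [Finset.sum_const, Finset.card_univ, nsmul_eq_mul, ← hN]
    field_simp
  have hint : ∀ c, Integrable (fun ω => N⁻¹ * (∑ b, μ b * (x b ω - x (c - b) ω)) ^ 4) P :=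
    fun c => integrable_of_continuous P (by fun_prop)
  calc _ ≤ ∫ ω, ∑ c : ι, N⁻¹ * (∑ b, μ b * (x b ω - x (c - b) ω)) ^ 4 ∂P :=
        integral_mono (integrable_of_continuous P (by fun_prop))
          (integrable_finsetSum _ fun c _ => hint c) jensen
    _ = ∑ c : ι, N⁻¹ * ∫ ω, (∑ b, μ b * (x b ω - x (c - b) ω)) ^ 4 ∂P := by
        rw [integral_finsetSum _ fun c _ => hint c]
        simp only [integral_const_mul]
    _ ≤ ∑ c : ι, N⁻¹ * (576 * (∑ b, μ b ^ 2) ^ 2 * m) := by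
        gcongr with c
        exact integral_involution_sum_pow_four_le P μ x hx hm (by
          intro p q
          obtain ⟨T, h1, h2⟩ := hT p q
          exact ⟨T, h1, fun b ω => by rw [h2]; congr!⟩)
          (σ := fun b => c - b) (fun b => sub_sub_cancel c b)
    _ = _ := by
        rw [Finset.sum_const, Finset.card_univ, nsmul_eq_mul, ← hN]
        field_simp

end FourthMoments

/-! ### Symmetries of Haar measure and moments of the entries of a Haar unitary. -/

section Haar

variable {n : Type*} [Fintype n] [DecidableEq n]

/-- The pushforward under right multiplication is again a Haar probability measure, and such a
measure is unique. -/
instance instIsMulRightInvariantHaarUnitary : (haarUnitary n).IsMulRightInvariant := by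
  refine ⟨fun g => ?_⟩
  have : IsProbabilityMeasure (Measure.map (fun x => x * g) (haarUnitary n)) :=
    Measure.isProbabilityMeasure_map (by fun_prop)
  exact Measure.isHaarMeasure_eq_of_isProbabilityMeasure _ _

@[fun_prop]
theorem continuous_entry (i j : n) :
    Continuous fun U : Matrix.unitaryGroup n ℂ => (U : Matrix n n ℂ) i j :=
  continuous_subtype_val.matrix_elem i j

/-- The diagonal unitary with phase `z` at `p` and `1` elsewhere. -/
def phase (p : n) (z : ℂ) (hz : z * star z = 1) : Matrix.unitaryGroup n ℂ :=
  ⟨Matrix.diagonal (Function.update 1 p z), by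
    rw [Matrix.mem_unitaryGroup_iff, Matrix.star_eq_conjTranspose, Matrix.diagonal_conjTranspose,
      Matrix.diagonal_mul_diagonal, ← Matrix.diagonal_one]
    congr 1
    ext i
    by_cases h : i = p
    · subst h; simpa using hz
    · simp [h]⟩

theorem phase_mul_apply (p : n) (z : ℂ) (hz : z * star z = 1) (U : Matrix.unitaryGroup n ℂ)
    (i j : n) : ((phase p z hz * U : Matrix.unitaryGroup n ℂ) : Matrix n n ℂ) i j =
      (if i = p then z else 1) * (U : Matrix n n ℂ) i j := by
  simp [phase, Matrix.diagonal_mul, Function.update_apply]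

/-- The permutation matrix of `τ`. -/
def permUnitary (τ : Equiv.Perm n) : Matrix.unitaryGroup n ℂ :=
  ⟨(1 : Matrix n n ℂ).submatrix τ id, by
    rw [Matrix.mem_unitaryGroup_iff, Matrix.star_eq_conjTranspose, Matrix.conjTranspose_submatrix,
      ← Matrix.submatrix_mul _ _ _ _ _ Function.bijective_id]
    simp⟩

theorem permUnitary_mul_apply (τ : Equiv.Perm n) (U : Matrix.unitaryGroup n ℂ) (i j : n) :
    ((permUnitary τ * U : Matrix.unitaryGroup n ℂ) : Matrix n n ℂ) i j =
      (U : Matrix n n ℂ) (τ i) j := by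
  simp [permUnitary, Matrix.mul_apply, Matrix.one_apply]

theorem mul_permUnitary_apply (τ : Equiv.Perm n) (U : Matrix.unitaryGroup n ℂ) (i j : n) :
    ((U * permUnitary τ : Matrix.unitaryGroup n ℂ) : Matrix n n ℂ) i j =
      (U : Matrix n n ℂ) i (τ.symm j) := by
  simp [permUnitary, Matrix.mul_apply, Matrix.one_apply, ← Equiv.eq_symm_apply]

/-- The matrix acting as a Hadamard rotation on the coordinates `p`, `q`. -/
def hadamardMatrix (p q : n) : Matrix n n ℂ := Matrix.of fun i j =>
  if i = p then ((Real.sqrt 2)⁻¹ : ℝ) * ((1 : Matrix n n ℂ) p j + (1 : Matrix n n ℂ) q j)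
  else if i = q then ((Real.sqrt 2)⁻¹ : ℝ) * ((1 : Matrix n n ℂ) p j - (1 : Matrix n n ℂ) q j)
  else (1 : Matrix n n ℂ) i j

theorem hadamardMatrix_mul_apply (p q : n) (M : Matrix n n ℂ) (i j : n) :
    (hadamardMatrix p q * M) i j =
      if i = p then ((Real.sqrt 2)⁻¹ : ℝ) * (M p j + M q j)
      else if i = q then ((Real.sqrt 2)⁻¹ : ℝ) * (M p j - M q j) else M i j := by
  rw [Matrix.mul_apply]
  simp only [hadamardMatrix, Matrix.of_apply]
  split_ifs <;>
    simp [mul_assoc, ← Finset.mul_sum, add_mul, sub_mul, Finset.sum_add_distrib,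
      Finset.sum_sub_distrib, Matrix.one_apply]

theorem inv_sqrt_two_mul_self : (((Real.sqrt 2)⁻¹ : ℝ) : ℂ) * ((Real.sqrt 2)⁻¹ : ℝ) = 1 / 2 := by
  rw [← Complex.ofReal_mul, ← mul_inv, Real.mul_self_sqrt (by norm_num)]
  norm_num

/-- The Hadamard rotation on the coordinates `p ≠ q`, as a unitary. -/
def hadamard (p q : n) (hpq : p ≠ q) : Matrix.unitaryGroup n ℂ :=
  ⟨hadamardMatrix p q, by
    have hs : star (hadamardMatrix p q) = hadamardMatrix p q := by
      ext i j
      rw [Matrix.star_apply]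
      generalize hc : (Real.sqrt 2)⁻¹ = c
      have o : ∀ a b : n, (1 : Matrix n n ℂ) a b = if b = a then 1 else 0 := fun a b => by
        rw [Matrix.one_apply]; exact if_congr eq_comm rfl rfl
      simp only [hadamardMatrix, Matrix.of_apply, hc]
      by_cases h1 : i = p <;> by_cases h2 : j = p <;> by_cases h3 : i = q <;>
        by_cases h4 : j = q <;>
        first
        | exact absurd (h1.symm.trans h3) hpq
        | exact absurd (h2.symm.trans h4) hpq
        | (rw [o i j]; simp [h1, h2, h3, h4, o, hpq, hpq.symm]; done)
        | (rw [o i j]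
           simp [h1, h2, h3, h4, o, hpq.symm]
           first
           | exact Ne.symm h1
           | exact Ne.symm h2
           | exact Ne.symm h3
           | exact Ne.symm h4
           | exact if_congr eq_comm rfl rfl)
    rw [Matrix.mem_unitaryGroup_iff, hs]
    ext i j
    rw [hadamardMatrix_mul_apply]
    have e := inv_sqrt_two_mul_self
    simp only [hadamardMatrix, Matrix.of_apply, if_true, if_neg hpq.symm]
    split_ifs with h1 h2
    · subst h1; linear_combination 2 * (1 : Matrix n n ℂ) i j * e
    · subst h2; linear_combination 2 * (1 : Matrix n n ℂ) i j * e
    · rfl⟩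

theorem hadamard_mul_apply (p q : n) (hpq : p ≠ q) (U : Matrix.unitaryGroup n ℂ) (i j : n) :
    ((hadamard p q hpq * U : Matrix.unitaryGroup n ℂ) : Matrix n n ℂ) i j =
      if i = p then ((Real.sqrt 2)⁻¹ : ℝ) * ((U : Matrix n n ℂ) p j + (U : Matrix n n ℂ) q j)
      else if i = q then
        ((Real.sqrt 2)⁻¹ : ℝ) * ((U : Matrix n n ℂ) p j - (U : Matrix n n ℂ) q j)
      else (U : Matrix n n ℂ) i j :=
  hadamardMatrix_mul_apply p q _ i j

theorem sum_normSq_col (U : Matrix.unitaryGroup n ℂ) (j : n) :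
    ∑ i, Complex.normSq ((U : Matrix n n ℂ) i j) = 1 := by
  have h := congrFun (congrFun (Matrix.mem_unitaryGroup_iff'.mp U.2) j) j
  rw [Matrix.mul_apply, Matrix.one_apply_eq] at h
  have h' := congrArg Complex.re h
  simp only [Complex.re_sum, Matrix.star_apply] at h'
  rw [Complex.one_re] at h'
  rw [← h']
  refine Finset.sum_congr rfl fun i _ => ?_
  simp [Complex.normSq_apply, Complex.mul_re]

theorem integral_normSq_pow_mul_swap (p q j : n) (k l : ℕ) :
    ∫ U : Matrix.unitaryGroup n ℂ, Complex.normSq ((U : Matrix n n ℂ) p j) ^ k *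
        Complex.normSq ((U : Matrix n n ℂ) q j) ^ l ∂haarUnitary n =
      ∫ U : Matrix.unitaryGroup n ℂ, Complex.normSq ((U : Matrix n n ℂ) q j) ^ k *
        Complex.normSq ((U : Matrix n n ℂ) p j) ^ l ∂haarUnitary n := by
  rw [← integral_mul_left_eq_self _ (permUnitary (Equiv.swap p q))]
  simp [permUnitary_mul_apply]

/-- Here `a = |u|²`, `b = |v|²`, `r = Re (u v̄)`, and the Hadamard rotation sends `a`, `b` to `(a +
b) / 2 ± r`. The mixed products cannot be small both before and after it. For `k = 3` and `b = 0`
the constant 8 is attained. -/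
theorem pow_add_pow_le_hadamard {a b r : ℝ} (ha : 0 ≤ a) (hb : 0 ≤ b) (hr : r ^ 2 ≤ a * b) {k : ℕ}
    (hk : 1 ≤ k) (hk3 : k ≤ 3) :
    a ^ (k + 1) + b ^ (k + 1) ≤ 8 * ((a ^ k * b + b ^ k * a) +
      (((a + b) / 2 + r) ^ k * ((a + b) / 2 - r) + ((a + b) / 2 - r) ^ k * ((a + b) / 2 + r))) := by
  have hab : 0 ≤ a * b := mul_nonneg ha hb
  have hs : 0 ≤ a + b := add_nonneg ha hb
  have hc : 0 ≤ (a + b) ^ 2 / 4 - r ^ 2 := by nlinarith [sq_nonneg (a - b)]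
  interval_cases k
  · nlinarith [sq_nonneg (a + b)]
  · have h : 0 ≤ (a + b) * (a * b - r ^ 2) := mul_nonneg hs (by linarith)
    nlinarith [mul_nonneg hs hab, pow_nonneg ha 3, pow_nonneg hb 3]
  · have h1 : 0 ≤ a * b * (a - b) ^ 2 := mul_nonneg hab (sq_nonneg _)
    have h2 : 0 ≤ ((a + b) ^ 2 / 4 - r ^ 2) * (4 * r ^ 2) := mul_nonneg hc (by positivity)
    have h3 : 0 ≤ (a + b) ^ 2 * (a * b - r ^ 2) := mul_nonneg (sq_nonneg _) (by linarith)
    have h4 : a ^ 4 + b ^ 4 ≤ (a + b) ^ 4 := by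
      have : 0 ≤ a * b * (4 * (a ^ 2 + b ^ 2) + 6 * (a * b)) := by positivity
      nlinarith
    nlinarith

/-- Integrating `pow_add_pow_le_hadamard` over Haar measure makes the rotated and unrotated mixed
terms equal, whence `16 = 2 · 8`. -/
theorem integral_normSq_pow_succ_le {p q : n} (hpq : p ≠ q) (j : n) {k : ℕ}
    (hk : 1 ≤ k) (hk3 : k ≤ 3) :
    ∫ U : Matrix.unitaryGroup n ℂ, Complex.normSq ((U : Matrix n n ℂ) p j) ^ (k + 1)
        ∂haarUnitary n ≤
      16 * ∫ U : Matrix.unitaryGroup n ℂ, Complex.normSq ((U : Matrix n n ℂ) p j) ^ k *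
        Complex.normSq ((U : Matrix n n ℂ) q j) ∂haarUnitary n := by
  have cN : ∀ i : n, Continuous fun U : Matrix.unitaryGroup n ℂ =>
      Complex.normSq ((U : Matrix n n ℂ) i j) :=
    fun i => Complex.continuous_normSq.comp (continuous_entry i j)
  let F : Matrix.unitaryGroup n ℂ → ℝ := fun U =>
    Complex.normSq ((U : Matrix n n ℂ) p j) ^ k * Complex.normSq ((U : Matrix n n ℂ) q j) +
    Complex.normSq ((U : Matrix n n ℂ) q j) ^ k * Complex.normSq ((U : Matrix n n ℂ) p j)
  have cF : Continuous F := by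
    have := cN p; have := cN q; fun_prop
  have cFH : Continuous fun U => F (hadamard p q hpq * U) :=
    cF.comp (continuous_const.mul continuous_id)
  have hFH : ∫ U, F (hadamard p q hpq * U) ∂haarUnitary n = ∫ U, F U ∂haarUnitary n :=
    integral_mul_left_eq_self F _
  have hF : ∫ U, F U ∂haarUnitary n = 2 * ∫ U : Matrix.unitaryGroup n ℂ,
      Complex.normSq ((U : Matrix n n ℂ) p j) ^ k *
        Complex.normSq ((U : Matrix n n ℂ) q j) ∂haarUnitary n := by
    have cp := cN p; have cq := cN q
    have h := integral_normSq_pow_mul_swap p q j k 1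
    simp only [pow_one] at h
    rw [integral_add (integrable_of_continuous _ (by fun_prop))
      (integrable_of_continuous _ (by fun_prop)), ← h]
    ring
  have hL : ∫ U : Matrix.unitaryGroup n ℂ, Complex.normSq ((U : Matrix n n ℂ) p j) ^ (k + 1) +
      Complex.normSq ((U : Matrix n n ℂ) q j) ^ (k + 1) ∂haarUnitary n =
      2 * ∫ U : Matrix.unitaryGroup n ℂ, Complex.normSq ((U : Matrix n n ℂ) p j) ^ (k + 1)
        ∂haarUnitary n := by
    have cp := cN p; have cq := cN q
    have h := integral_normSq_pow_mul_swap p q j (k + 1) 0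
    simp only [pow_zero, mul_one] at h
    rw [integral_add (integrable_of_continuous _ (by fun_prop))
      (integrable_of_continuous _ (by fun_prop)), ← h]
    ring
  have hmono : ∫ U : Matrix.unitaryGroup n ℂ, Complex.normSq ((U : Matrix n n ℂ) p j) ^ (k + 1) +
      Complex.normSq ((U : Matrix n n ℂ) q j) ^ (k + 1) ∂haarUnitary n ≤
      ∫ U, 8 * (F U + F (hadamard p q hpq * U)) ∂haarUnitary n := by
    have cp := cN p; have cq := cN q
    refine integral_mono (integrable_of_continuous _ (by fun_prop))
      (integrable_of_continuous _ (by fun_prop)) fun U => ?_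
    generalize hu : (U : Matrix n n ℂ) p j = u
    generalize hv : (U : Matrix n n ℂ) q j = v
    have e : (Real.sqrt 2)⁻¹ * (Real.sqrt 2)⁻¹ = (1 / 2 : ℝ) := by
      rw [← mul_inv, Real.mul_self_sqrt (by norm_num)]; norm_num
    have e1 : Complex.normSq (((Real.sqrt 2)⁻¹ : ℝ) * (u + v)) =
        (Complex.normSq u + Complex.normSq v) / 2 + (u * star v).re := by
      rw [Complex.normSq_mul, Complex.normSq_ofReal, e, Complex.normSq_add]
      simp only [Complex.star_def]; ring
    have e2 : Complex.normSq (((Real.sqrt 2)⁻¹ : ℝ) * (u - v)) =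
        (Complex.normSq u + Complex.normSq v) / 2 - (u * star v).re := by
      rw [Complex.normSq_mul, Complex.normSq_ofReal, e, Complex.normSq_sub]
      simp only [Complex.star_def]; ring
    have hr : (u * star v).re ^ 2 ≤ Complex.normSq u * Complex.normSq v := by
      have h1 : Complex.normSq (u * star v) = Complex.normSq u * Complex.normSq v := by
        rw [Complex.normSq_mul, Complex.star_def, Complex.normSq_conj]
      rw [← h1, Complex.normSq_apply]
      nlinarith [sq_nonneg (u * star v).im]
    have := pow_add_pow_le_hadamard (Complex.normSq_nonneg u) (Complex.normSq_nonneg v) hr hk hk3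
    simpa only [F, hadamard_mul_apply, if_true, if_neg hpq.symm, hu, hv, e1, e2] using this
  rw [integral_const_mul, integral_add (integrable_of_continuous _ cF)
    (integrable_of_continuous _ cFH), hFH, hF, hL] at hmono
  linarith

theorem integral_normSq_pow_eq_sum (p j : n) (k : ℕ) :
    ∫ U : Matrix.unitaryGroup n ℂ, Complex.normSq ((U : Matrix n n ℂ) p j) ^ k ∂haarUnitary n =
      ∑ q, ∫ U : Matrix.unitaryGroup n ℂ, Complex.normSq ((U : Matrix n n ℂ) p j) ^ k *
        Complex.normSq ((U : Matrix n n ℂ) q j) ∂haarUnitary n := by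
  have cN : ∀ i : n, Continuous fun U : Matrix.unitaryGroup n ℂ =>
      Complex.normSq ((U : Matrix n n ℂ) i j) :=
    fun i => Complex.continuous_normSq.comp (continuous_entry i j)
  rw [← integral_finsetSum _ fun q _ =>
    integrable_of_continuous _ (by have := cN p; have := cN q; fun_prop)]
  simp only [← Finset.mul_sum, sum_normSq_col, mul_one]

/-- Summing the mixed moments over `q` uses that each column is a unit vector, giving a recursion in
`k` that gains a factor `16 / d` per step. -/
theorem card_mul_integral_normSq_pow_succ_le (p j : n) {k : ℕ} (hk : 1 ≤ k) (hk3 : k ≤ 3) :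
    Fintype.card n * ∫ U : Matrix.unitaryGroup n ℂ,
        Complex.normSq ((U : Matrix n n ℂ) p j) ^ (k + 1) ∂haarUnitary n ≤
      16 * ∫ U : Matrix.unitaryGroup n ℂ, Complex.normSq ((U : Matrix n n ℂ) p j) ^ k
        ∂haarUnitary n := by
  rw [integral_normSq_pow_eq_sum p j k, Finset.mul_sum, ← nsmul_eq_mul, ← Finset.card_univ,
    ← Finset.sum_const]
  refine Finset.sum_le_sum fun q _ => ?_
  by_cases h : p = q
  · subst h
    simp only [← pow_succ]
    have : 0 ≤ ∫ U : Matrix.unitaryGroup n ℂ,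
        Complex.normSq ((U : Matrix n n ℂ) p j) ^ (k + 1) ∂haarUnitary n :=
      integral_nonneg fun U => pow_nonneg (Complex.normSq_nonneg _) _
    linarith
  · exact integral_normSq_pow_succ_le h j hk hk3

/-- Eighth absolute moment of an entry of a Haar unitary. -/
theorem integral_normSq_pow_four_le (p j : n) :
    ∫ U : Matrix.unitaryGroup n ℂ, Complex.normSq ((U : Matrix n n ℂ) p j) ^ 4 ∂haarUnitary n ≤
      4096 / (Fintype.card n : ℝ) ^ 4 := by
  have hd : 0 < (Fintype.card n : ℝ) := by
    have : Nonempty n := ⟨p⟩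
    exact_mod_cast Fintype.card_pos
  have h1 := integral_normSq_pow_eq_sum p j 0
  have hsw : ∀ q, ∫ U : Matrix.unitaryGroup n ℂ, Complex.normSq ((U : Matrix n n ℂ) q j)
      ∂haarUnitary n = ∫ U : Matrix.unitaryGroup n ℂ, Complex.normSq ((U : Matrix n n ℂ) p j)
      ∂haarUnitary n := fun q => by
    simpa using integral_normSq_pow_mul_swap q p j 1 0
  -- The case `k = 0` gives `E |U_pj|² = 1 / d`; three steps of the recursion then give `16³ / d⁴`,
  -- with `16³ = 4096`.
  simp only [pow_zero, one_mul, hsw, integral_const, probReal_univ, smul_eq_mul, mul_one,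
    Finset.sum_const, Finset.card_univ, nsmul_eq_mul] at h1
  have h2 := card_mul_integral_normSq_pow_succ_le p j (k := 1) le_rfl (by norm_num)
  have h3 := card_mul_integral_normSq_pow_succ_le p j (k := 2) (by norm_num) (by norm_num)
  have h4 := card_mul_integral_normSq_pow_succ_le p j (k := 3) (by norm_num) le_rfl
  simp only [pow_one, Nat.reduceAdd] at h2 h3 h4
  rw [le_div_iff₀ (by positivity)]
  set d : ℝ := (Fintype.card n : ℝ)
  have e2 := mul_le_mul_of_nonneg_left h2 hd.le
  have e3 := mul_le_mul_of_nonneg_left h3 (pow_nonneg hd.le 2)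
  have e4 := mul_le_mul_of_nonneg_left h4 (pow_nonneg hd.le 3)
  linarith

/-- Left permutations make the entries of a column exchangeable, and right permutations make the
column statistics exchangeable; each use costs a factor 576. -/
theorem integral_centred_bilinear_pow_four_le (lam μ : n → ℝ) (hlam : ∑ a, lam a = 0)
    (hμ : ∑ b, μ b = 0) :
    ∫ U : Matrix.unitaryGroup n ℂ, (∑ a, lam a * ∑ b, μ b *
        Complex.normSq ((U : Matrix n n ℂ) b a)) ^ 4 ∂haarUnitary n ≤
      576 ^ 2 * 4096 * ((∑ a, lam a ^ 2) * ∑ b, μ b ^ 2) ^ 2 / (Fintype.card n : ℝ) ^ 4 := by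
  have cN : ∀ i j : n, Continuous fun U : Matrix.unitaryGroup n ℂ =>
      Complex.normSq ((U : Matrix n n ℂ) i j) :=
    fun i j => Complex.continuous_normSq.comp (continuous_entry i j)
  have inner (a : n) := integral_exchangeable_sum_pow_four_le (haarUnitary n) μ hμ
    (fun b U => Complex.normSq ((U : Matrix n n ℂ) b a)) (fun b => cN b a)
    (fun b => integral_normSq_pow_four_le b a) (fun p q =>
      ⟨fun U => permUnitary (Equiv.swap p q) * U, fun f => integral_mul_left_eq_self f _,
        fun b U => by simp only [permUnitary_mul_apply]⟩)
  have outer := integral_exchangeable_sum_pow_four_le (haarUnitary n) lam hlam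
    (fun a U => ∑ b, μ b * Complex.normSq ((U : Matrix n n ℂ) b a)) (fun a => by
      have := cN; fun_prop) inner (fun p q =>
      ⟨fun U => U * permUnitary (Equiv.swap p q), fun f => integral_mul_right_eq_self f _,
        fun b U => by simp only [mul_permUnitary_apply, Equiv.symm_swap]⟩)
  refine outer.trans (le_of_eq ?_)
  ring

/-- Since columns are unit vectors and `lam` is centred, subtracting the mean `c` from `μ` leaves
the form unchanged and does not increase `∑ μ²`. -/
theorem integral_bilinear_pow_four_le (lam μ : n → ℝ) (hlam : ∑ a, lam a = 0) :
    ∫ U : Matrix.unitaryGroup n ℂ, (∑ a, lam a * ∑ b, μ b *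
        Complex.normSq ((U : Matrix n n ℂ) b a)) ^ 4 ∂haarUnitary n ≤
      576 ^ 2 * 4096 * ((∑ a, lam a ^ 2) * ∑ b, μ b ^ 2) ^ 2 / (Fintype.card n : ℝ) ^ 4 := by
  rcases isEmpty_or_nonempty n with hn | hn
  · simp
  have hd : 0 < (Fintype.card n : ℝ) := by exact_mod_cast Fintype.card_pos
  obtain ⟨c, hc⟩ : ∃ c : ℝ, Fintype.card n * c = ∑ b, μ b :=
    ⟨(∑ b, μ b) / Fintype.card n, by field_simp⟩
  have h0 : ∑ b, (μ b - c) = 0 := by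
    rw [Finset.sum_sub_distrib, Finset.sum_const, Finset.card_univ, nsmul_eq_mul, hc, sub_self]
  have hsq : ∑ b, (μ b - c) ^ 2 ≤ ∑ b, μ b ^ 2 := by
    have : ∑ b, (μ b - c) ^ 2 = ∑ b, μ b ^ 2 - 2 * c * ∑ b, μ b + Fintype.card n * c ^ 2 := by
      simp only [sub_sq, Finset.sum_add_distrib, Finset.sum_sub_distrib, Finset.sum_const,
        Finset.card_univ, nsmul_eq_mul, Finset.mul_sum]
      congr 2
      exact Finset.sum_congr rfl fun _ _ => by ring
    rw [this, ← hc]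
    nlinarith [mul_nonneg hd.le (sq_nonneg c)]
  have h := integral_centred_bilinear_pow_four_le lam (fun b => μ b - c) hlam h0
  simp only [sub_mul, Finset.sum_sub_distrib, ← Finset.mul_sum, sum_normSq_col, mul_sub, mul_one,
    ← Finset.sum_mul, hlam, zero_mul, sub_zero] at h
  refine h.trans ?_
  have : 0 ≤ ∑ a, lam a ^ 2 := Finset.sum_nonneg fun _ _ => sq_nonneg _
  have : 0 ≤ ∑ b, (μ b - c) ^ 2 := Finset.sum_nonneg fun _ _ => sq_nonneg _
  gcongr

end Haar

/-! ### Hilbert–Schmidt norm, conjugation by unitaries, and fourth moments of linear functionals. -/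

theorem trace_conjTranspose_mul_self_re {n : Type*} [Fintype n] (M : Matrix n n ℂ) :
    (Mᴴ * M).trace.re = ∑ i, ∑ j, Complex.normSq (M i j) := by
  rw [Finset.sum_comm, Matrix.trace, Complex.re_sum]
  refine Finset.sum_congr rfl fun j _ => ?_
  rw [Matrix.diag_apply, Matrix.mul_apply, Complex.re_sum]
  refine Finset.sum_congr rfl fun i _ => ?_
  simp [Complex.normSq_apply, Complex.mul_re]

theorem hsNorm_sq {n : Type*} [Fintype n] (M : Matrix n n ℂ) :
    hsNorm M ^ 2 = ∑ i, ∑ j, Complex.normSq (M i j) := by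
  have h := trace_conjTranspose_mul_self_re M
  rw [hsNorm, Real.sq_sqrt, h]
  rw [h]
  exact Finset.sum_nonneg fun i _ => Finset.sum_nonneg fun j _ => Complex.normSq_nonneg _

section Conjugation

variable {n : Type*} [Fintype n] [DecidableEq n]

/-- Conjugation of a matrix by a unitary. -/
def conjUnitary (D : Matrix n n ℂ) (U : Matrix.unitaryGroup n ℂ) : Matrix n n ℂ :=
  (U : Matrix n n ℂ) * D * (U : Matrix n n ℂ)ᴴ

theorem conjUnitary_mul (D : Matrix n n ℂ) (G U : Matrix.unitaryGroup n ℂ) :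
    conjUnitary D (G * U) = (G : Matrix n n ℂ) * conjUnitary D U * (G : Matrix n n ℂ)ᴴ := by
  simp [conjUnitary, Matrix.mul_assoc, Matrix.conjTranspose_mul]

theorem unitary_conjTranspose_mul_self (U : Matrix.unitaryGroup n ℂ) :
    (U : Matrix n n ℂ)ᴴ * (U : Matrix n n ℂ) = 1 :=
  Matrix.mem_unitaryGroup_iff'.mp U.2

@[fun_prop]
theorem continuous_conjUnitary_apply (D : Matrix n n ℂ) (i j : n) :
    Continuous fun U : Matrix.unitaryGroup n ℂ => conjUnitary D U i j := by
  have h : Continuous fun U : Matrix.unitaryGroup n ℂ => conjUnitary D U := by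
    unfold conjUnitary
    have := continuous_subtype_val (p := fun U => U ∈ Matrix.unitaryGroup n ℂ)
    fun_prop
  exact h.matrix_elem i j

theorem conjUnitary_isHermitian {D : Matrix n n ℂ} (hD : D.IsHermitian)
    (U : Matrix.unitaryGroup n ℂ) : (conjUnitary D U).IsHermitian :=
  Matrix.isHermitian_mul_mul_conjTranspose _ hD

theorem trace_conjUnitary (D : Matrix n n ℂ) (U : Matrix.unitaryGroup n ℂ) :
    (conjUnitary D U).trace = D.trace := by
  rw [conjUnitary, Matrix.trace_mul_comm, ← Matrix.mul_assoc, unitary_conjTranspose_mul_self,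
    Matrix.one_mul]

theorem sum_normSq_conjUnitary (D : Matrix n n ℂ) (U : Matrix.unitaryGroup n ℂ) :
    ∑ i, ∑ j, Complex.normSq (conjUnitary D U i j) = hsNorm D ^ 2 := by
  rw [hsNorm_sq, ← trace_conjTranspose_mul_self_re, ← trace_conjTranspose_mul_self_re]
  congr 1
  have : (conjUnitary D U)ᴴ * conjUnitary D U = conjUnitary (Dᴴ * D) U := by
    simp only [conjUnitary, Matrix.conjTranspose_mul, Matrix.conjTranspose_conjTranspose]
    calc _ = (U : Matrix n n ℂ) * Dᴴ * ((U : Matrix n n ℂ)ᴴ * (U : Matrix n n ℂ)) * D *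
          (U : Matrix n n ℂ)ᴴ := by simp only [Matrix.mul_assoc]
      _ = _ := by rw [unitary_conjTranspose_mul_self]; simp only [Matrix.mul_assoc, Matrix.one_mul]
  rw [this, trace_conjUnitary]

theorem exists_eq_conjUnitary_diagonal {D : Matrix n n ℂ} (hD : D.IsHermitian) :
    ∃ (V : Matrix.unitaryGroup n ℂ) (lam : n → ℝ),
      D = conjUnitary (Matrix.diagonal fun i => (lam i : ℂ)) V ∧
      ((∑ i, lam i : ℝ) : ℂ) = D.trace ∧ ∑ i, lam i ^ 2 = hsNorm D ^ 2 := by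
  have h : D = conjUnitary (Matrix.diagonal fun i => (hD.eigenvalues i : ℂ))
      hD.eigenvectorUnitary := by
    conv_lhs => rw [hD.spectral_theorem]
    rfl
  refine ⟨hD.eigenvectorUnitary, hD.eigenvalues, h, ?_, ?_⟩
  · conv_rhs => rw [h, trace_conjUnitary, Matrix.trace_diagonal]
    push_cast; rfl
  · conv_rhs => rw [h, hsNorm_sq, sum_normSq_conjUnitary, hsNorm_sq]
    refine Finset.sum_congr rfl fun i _ => ?_
    rw [Finset.sum_eq_single i (fun j _ hj => by simp [Matrix.diagonal_apply_ne' _ hj]) (by simp),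
      Matrix.diagonal_apply_eq, Complex.normSq_ofReal, sq]

theorem trace_conjUnitary_conjUnitary_diagonal (lam μ : n → ℝ) (V W U : Matrix.unitaryGroup n ℂ) :
    (conjUnitary (conjUnitary (Matrix.diagonal fun i => (lam i : ℂ)) V) (W * U * V⁻¹) *
      conjUnitary (Matrix.diagonal fun i => (μ i : ℂ)) W).trace =
    ((∑ a, lam a * ∑ b, μ b * Complex.normSq ((U : Matrix n n ℂ) b a) : ℝ) : ℂ) := by
  have e1 : conjUnitary (conjUnitary (Matrix.diagonal fun i => (lam i : ℂ)) V) (W * U * V⁻¹) =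
      conjUnitary (Matrix.diagonal fun i => (lam i : ℂ)) (W * U) := by
    have : ∀ G : Matrix.unitaryGroup n ℂ, conjUnitary (Matrix.diagonal fun i => (lam i : ℂ)) (G * V) =
      conjUnitary (conjUnitary (Matrix.diagonal fun i => (lam i : ℂ)) V) G :=
      fun G => conjUnitary_mul _ _ _
    rw [← this]; simp
  rw [e1, conjUnitary_mul]
  generalize hA : conjUnitary (Matrix.diagonal fun i => (lam i : ℂ)) U = A
  have e2 : (W : Matrix n n ℂ) * A * (W : Matrix n n ℂ)ᴴ *
      conjUnitary (Matrix.diagonal fun i => (μ i : ℂ)) W =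
      conjUnitary (A * Matrix.diagonal fun i => (μ i : ℂ)) W := by
    unfold conjUnitary
    calc _ = (W : Matrix n n ℂ) * A * ((W : Matrix n n ℂ)ᴴ * (W : Matrix n n ℂ)) *
          (Matrix.diagonal fun i => (μ i : ℂ)) * (W : Matrix n n ℂ)ᴴ := by
            simp only [Matrix.mul_assoc]
      _ = _ := by rw [unitary_conjTranspose_mul_self]; simp only [Matrix.mul_assoc, Matrix.one_mul]
  have hAb : ∀ b, A b b = ∑ a, (lam a : ℂ) * (Complex.normSq ((U : Matrix n n ℂ) b a) : ℂ) := by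
    intro b
    rw [← hA, conjUnitary, Matrix.mul_apply]
    refine Finset.sum_congr rfl fun a _ => ?_
    rw [Matrix.mul_diagonal, Matrix.conjTranspose_apply, Complex.normSq_eq_conj_mul_self,
      Complex.star_def]
    ring
  rw [e2, trace_conjUnitary, Matrix.trace]
  simp only [Matrix.diag_apply, Matrix.mul_diagonal, hAb, Finset.sum_mul, Finset.mul_sum]
  push_cast
  rw [Finset.sum_comm]
  exact Finset.sum_congr rfl fun a _ => Finset.sum_congr rfl fun b _ => by ring

theorem integral_trace_hermitian_pow_four_le {D H : Matrix n n ℂ} (hD : D.IsHermitian)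
    (hD0 : D.trace = 0) (hH : H.IsHermitian) :
    ∫ U, (conjUnitary D U * H).trace.re ^ 4 ∂haarUnitary n ≤
      576 ^ 2 * 4096 * (hsNorm D ^ 2 * hsNorm H ^ 2) ^ 2 / (Fintype.card n : ℝ) ^ 4 := by
  obtain ⟨V, lam, hV, hl, hl2⟩ := exists_eq_conjUnitary_diagonal hD
  obtain ⟨W, μ, hW, -, hm2⟩ := exists_eq_conjUnitary_diagonal hH
  rw [← hl2, ← hm2]
  rw [hD0] at hl
  -- Two-sided invariance absorbs both eigenbases, leaving only eigenvalues and the `|U_ba|²`.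
  rw [← integral_mul_left_eq_self _ W, ← integral_mul_right_eq_self _ V⁻¹]
  refine le_trans (le_of_eq ?_) (integral_bilinear_pow_four_le lam μ (by exact_mod_cast hl))
  congr 1
  ext U
  rw [hV, hW, ← mul_assoc, trace_conjUnitary_conjUnitary_diagonal, Complex.ofReal_re]

theorem continuous_trace_conjUnitary_mul (D G : Matrix n n ℂ) :
    Continuous fun U : Matrix.unitaryGroup n ℂ => (conjUnitary D U * G).trace := by
  simp only [Matrix.trace, Matrix.diag_apply, Matrix.mul_apply]
  fun_prop

/-- Fourth absolute moment of a linear functional of a randomly rotated traceless observable. -/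
theorem integral_normSq_trace_sq_le {D : Matrix n n ℂ} (hD : D.IsHermitian)
    (hD0 : D.trace = 0) (G : Matrix n n ℂ) :
    ∫ U, Complex.normSq (conjUnitary D U * G).trace ^ 2 ∂haarUnitary n ≤
      4 * (576 ^ 2 * 4096) * (hsNorm D ^ 2 * hsNorm G ^ 2) ^ 2 / (Fintype.card n : ℝ) ^ 4 := by
  -- Hermitian and skew parts, `G = H₁ + i H₂`, neither of larger norm than `G`. Both traces are
  -- real, so they are the real and imaginary parts of `tr (U D U† G)`.
  let H₁ : Matrix n n ℂ := (1 / 2 : ℂ) • (G + Gᴴ)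
  let H₂ : Matrix n n ℂ := (-Complex.I / 2) • (G - Gᴴ)
  have h1 : H₁.IsHermitian := by
    simp [H₁, Matrix.IsHermitian, Matrix.conjTranspose_smul, add_comm]
  have h2 : H₂.IsHermitian := by
    simp only [H₂, Matrix.IsHermitian, Matrix.conjTranspose_smul, Matrix.conjTranspose_sub,
      Matrix.conjTranspose_conjTranspose]
    rw [← neg_sub G, smul_neg, ← neg_smul]
    simp [neg_div]
  have swap : ∑ i, ∑ j, Complex.normSq (G j i) = ∑ i, ∑ j, Complex.normSq (G i j) :=
    Finset.sum_comm
  have bound : ∀ H : Matrix n n ℂ, (∀ i j, Complex.normSq (H i j) ≤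
      (Complex.normSq (G i j) + Complex.normSq (G j i)) / 2) → hsNorm H ^ 2 ≤ hsNorm G ^ 2 := by
    intro H hH
    rw [hsNorm_sq, hsNorm_sq]
    calc _ ≤ ∑ i, ∑ j, (Complex.normSq (G i j) + Complex.normSq (G j i)) / 2 :=
          Finset.sum_le_sum fun i _ => Finset.sum_le_sum fun j _ => hH i j
      _ = _ := by
          simp only [← Finset.sum_div, Finset.sum_add_distrib]
          rw [swap]; ring
  have b1 : hsNorm H₁ ^ 2 ≤ hsNorm G ^ 2 := bound _ fun i j => by
    simp only [H₁, Matrix.smul_apply, Matrix.add_apply, Matrix.conjTranspose_apply,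
      Complex.normSq_apply, smul_eq_mul, Complex.star_def]
    simp
    nlinarith [sq_nonneg ((G i j).re - (G j i).re), sq_nonneg ((G i j).im + (G j i).im)]
  have b2 : hsNorm H₂ ^ 2 ≤ hsNorm G ^ 2 := bound _ fun i j => by
    simp only [H₂, Matrix.smul_apply, Matrix.sub_apply, Matrix.conjTranspose_apply,
      Complex.normSq_apply, smul_eq_mul, Complex.star_def]
    simp
    nlinarith [sq_nonneg ((G i j).re + (G j i).re), sq_nonneg ((G i j).im - (G j i).im)]
  have hG : G = H₁ + Complex.I • H₂ := by
    simp only [H₁, H₂, smul_smul]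
    rw [show Complex.I * (-Complex.I / 2) = 1 / 2 by
      rw [mul_div_assoc', mul_neg, Complex.I_mul_I, neg_neg], ← smul_add, add_add_sub_cancel,
      ← two_smul ℂ G, smul_smul]
    norm_num
  have real : ∀ (H : Matrix n n ℂ), H.IsHermitian → ∀ U,
      (conjUnitary D U * H).trace.im = 0 := by
    intro H hH U
    have : star (conjUnitary D U * H).trace = (conjUnitary D U * H).trace := by
      rw [← Matrix.trace_conjTranspose, Matrix.conjTranspose_mul, hH.eq,
        (conjUnitary_isHermitian hD U).eq, Matrix.trace_mul_comm]
    exact Complex.conj_eq_iff_im.mp this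
  have pt : ∀ U, Complex.normSq (conjUnitary D U * G).trace ^ 2 ≤
      2 * (conjUnitary D U * H₁).trace.re ^ 4 + 2 * (conjUnitary D U * H₂).trace.re ^ 4 := by
    intro U
    have e : (conjUnitary D U * G).trace =
        (conjUnitary D U * H₁).trace + Complex.I * (conjUnitary D U * H₂).trace := by
      conv_lhs => rw [hG]
      rw [Matrix.mul_add, Matrix.trace_add, Matrix.mul_smul (conjUnitary D U) Complex.I H₂,
        Matrix.trace_smul Complex.I (conjUnitary D U * H₂), smul_eq_mul]
    rw [e, Complex.normSq_apply]
    simp only [Complex.add_re, Complex.add_im, Complex.mul_re, Complex.mul_im, Complex.I_re,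
      Complex.I_im, real _ h1, real _ h2]
    nlinarith [sq_nonneg ((conjUnitary D U * H₁).trace.re ^ 2 -
      (conjUnitary D U * H₂).trace.re ^ 2)]
  have c1 := continuous_trace_conjUnitary_mul D H₁
  have c2 := continuous_trace_conjUnitary_mul D H₂
  have c3 := Complex.continuous_normSq.comp (continuous_trace_conjUnitary_mul D G)
  have c1' := Complex.continuous_re.comp c1
  have c2' := Complex.continuous_re.comp c2
  simp only [Function.comp_def] at c1' c2' c3
  have i1 := integral_trace_hermitian_pow_four_le hD hD0 h1
  have i2 := integral_trace_hermitian_pow_four_le hD hD0 h2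
  have I := integral_mono (μ := haarUnitary n) (integrable_of_continuous _ (by fun_prop))
    (integrable_of_continuous _ (by fun_prop)) pt
  rw [integral_add (integrable_of_continuous _ (by fun_prop))
    (integrable_of_continuous _ (by fun_prop)), integral_const_mul, integral_const_mul] at I
  have m1 : 576 ^ 2 * 4096 * (hsNorm D ^ 2 * hsNorm H₁ ^ 2) ^ 2 / (Fintype.card n : ℝ) ^ 4 ≤
      576 ^ 2 * 4096 * (hsNorm D ^ 2 * hsNorm G ^ 2) ^ 2 / (Fintype.card n : ℝ) ^ 4 := by gcongr
  have m2 : 576 ^ 2 * 4096 * (hsNorm D ^ 2 * hsNorm H₂ ^ 2) ^ 2 / (Fintype.card n : ℝ) ^ 4 ≤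
      576 ^ 2 * 4096 * (hsNorm D ^ 2 * hsNorm G ^ 2) ^ 2 / (Fintype.card n : ℝ) ^ 4 := by gcongr
  refine I.trans ?_
  rw [mul_assoc 4, mul_div_assoc 4]
  linarith

end Conjugation

/-! ### Exact second moments of the entries of `U D U†`. -/

section SecondMoments

variable {n : Type*} [Fintype n] [DecidableEq n]

theorem conjUnitary_permUnitary_mul (D : Matrix n n ℂ) (τ : Equiv.Perm n)
    (U : Matrix.unitaryGroup n ℂ) (i j : n) :
    conjUnitary D (permUnitary τ * U) i j = conjUnitary D U (τ i) (τ j) := by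
  simp only [conjUnitary, Matrix.mul_apply, permUnitary_mul_apply, Matrix.conjTranspose_apply]

theorem conjUnitary_phase_mul (D : Matrix n n ℂ) (p : n) (z : ℂ) (hz : z * star z = 1)
    (U : Matrix.unitaryGroup n ℂ) (i j : n) :
    conjUnitary D (phase p z hz * U) i j =
      (if i = p then z else 1) * star (if j = p then z else 1) * conjUnitary D U i j := by
  simp only [conjUnitary, Matrix.mul_apply, phase_mul_apply, Matrix.conjTranspose_apply,
    Finset.mul_sum, Finset.sum_mul, star_mul']
  exact Finset.sum_congr rfl fun _ _ => Finset.sum_congr rfl fun _ _ => by ring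

theorem conjUnitary_hadamard_mul_apply_self_re {D : Matrix n n ℂ} (hD : D.IsHermitian) {p q : n}
    (hpq : p ≠ q) (U : Matrix.unitaryGroup n ℂ) :
    (conjUnitary D (hadamard p q hpq * U) p p).re =
      ((conjUnitary D U p p).re + (conjUnitary D U q q).re) / 2 + (conjUnitary D U p q).re := by
  have e : (Real.sqrt 2)⁻¹ * (Real.sqrt 2)⁻¹ = (1 / 2 : ℝ) := by
    rw [← mul_inv, Real.mul_self_sqrt (by norm_num)]; norm_num
  have hh : (conjUnitary D U q p).re = (conjUnitary D U p q).re := by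
    rw [← (conjUnitary_isHermitian hD U).apply p q, Complex.star_def, Complex.conj_re]
  have h1 : conjUnitary D (hadamard p q hpq * U) =
      hadamardMatrix p q * (hadamardMatrix p q * conjUnitary D U)ᴴ := by
    rw [conjUnitary_mul, Matrix.conjTranspose_mul, (conjUnitary_isHermitian hD U).eq,
      Matrix.mul_assoc]
    rfl
  rw [h1, hadamardMatrix_mul_apply, if_pos rfl, Matrix.conjTranspose_apply,
    Matrix.conjTranspose_apply, hadamardMatrix_mul_apply, hadamardMatrix_mul_apply, if_pos rfl,
    if_pos rfl, Complex.re_ofReal_mul, Complex.add_re]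
  simp only [Complex.star_def, Complex.conj_re, Complex.re_ofReal_mul, Complex.add_re, hh]
  linear_combination ((conjUnitary D U p p).re + (conjUnitary D U q q).re +
    2 * (conjUnitary D U p q).re) * e

theorem integral_conjUnitary_perm (D : Matrix n n ℂ) (τ : Equiv.Perm n)
    (f : Matrix n n ℂ → ℝ) :
    ∫ U, f ((conjUnitary D U).submatrix τ τ) ∂haarUnitary n =
      ∫ U, f (conjUnitary D U) ∂haarUnitary n := by
  rw [← integral_mul_left_eq_self (fun U => f (conjUnitary D U)) (permUnitary τ)]
  congr 1; ext U; congr 1; ext i j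
  rw [Matrix.submatrix_apply, conjUnitary_permUnitary_mul]

theorem integral_diag_sq_eq {D : Matrix n n ℂ} (p q : n) :
    ∫ U, (conjUnitary D U q q).re ^ 2 ∂haarUnitary n =
      ∫ U, (conjUnitary D U p p).re ^ 2 ∂haarUnitary n := by
  have := integral_conjUnitary_perm D (Equiv.swap p q) fun A => (A p p).re ^ 2
  simpa using this

theorem integral_normSq_offDiag_eq {D : Matrix n n ℂ} {p q p' q' : n} (h : p ≠ q) (h' : p' ≠ q') :
    ∫ U, Complex.normSq (conjUnitary D U p' q') ∂haarUnitary n =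
      ∫ U, Complex.normSq (conjUnitary D U p q) ∂haarUnitary n := by
  have h1 : Equiv.swap p p' q ≠ p' := fun e =>
    h ((Equiv.swap p p').injective (e.trans (Equiv.swap_apply_left p p').symm)).symm
  -- This permutation carries `p` to `p'` and `q` to `q'`: the second swap moves neither endpoint
  -- onto `p'`.
  have := integral_conjUnitary_perm D
    ((Equiv.swap p p').trans (Equiv.swap (Equiv.swap p p' q) q')) fun A => Complex.normSq (A p q)
  simpa [Equiv.swap_apply_of_ne_of_ne h1.symm h'] using this

/-- The Hadamard rotation turns `A_pp` into `(A_pp + A_qq) / 2 + Re A_pq` without changing its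
second moment; expanding the square gives the relation. -/
theorem integral_diag_sq_eq_add {D : Matrix n n ℂ} (hD : D.IsHermitian) {p q : n} (h : p ≠ q) :
    ∫ U, (conjUnitary D U p p).re ^ 2 ∂haarUnitary n =
      ∫ U, (conjUnitary D U p p).re * (conjUnitary D U q q).re ∂haarUnitary n +
      ∫ U, Complex.normSq (conjUnitary D U p q) ∂haarUnitary n := by
  have c : ∀ i j, Continuous fun U : Matrix.unitaryGroup n ℂ => (conjUnitary D U i j).re :=
    fun i j => Complex.continuous_re.comp (continuous_conjUnitary_apply D i j)
  have c' : ∀ i j, Continuous fun U : Matrix.unitaryGroup n ℂ => (conjUnitary D U i j).im :=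
    fun i j => Complex.continuous_im.comp (continuous_conjUnitary_apply D i j)
  have cp := c p p
  have cq := c q q
  have cr := c p q
  have ci := c' p q
  have hH := integral_mul_left_eq_self (μ := haarUnitary n)
    (fun U => (conjUnitary D U p p).re ^ 2) (hadamard p q h)
  simp only [conjUnitary_hadamard_mul_apply_self_re hD] at hH
  -- The phase `-1` at `p` kills the cross term; the phase `i` below equates the second moments of
  -- `Re A_pq` and `Im A_pq`.
  have hflip := integral_mul_left_eq_self (μ := haarUnitary n)
    (fun U => ((conjUnitary D U p p).re + (conjUnitary D U q q).re) * (conjUnitary D U p q).re)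
    (phase p (-1) (by simp))
  have hI := integral_mul_left_eq_self (μ := haarUnitary n)
    (fun U => (conjUnitary D U p q).re ^ 2) (phase p Complex.I (by simp))
  simp [conjUnitary_phase_mul, h.symm, integral_neg] at hflip hI
  have hflip0 : ∫ U, ((conjUnitary D U p p).re + (conjUnitary D U q q).re) *
      (conjUnitary D U p q).re ∂haarUnitary n = 0 := by linarith
  have hexp : ∫ U, (((conjUnitary D U p p).re + (conjUnitary D U q q).re) / 2 +
      (conjUnitary D U p q).re) ^ 2 ∂haarUnitary n =
      1 / 4 * ∫ U, (conjUnitary D U p p).re ^ 2 ∂haarUnitary n +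
      1 / 4 * ∫ U, (conjUnitary D U q q).re ^ 2 ∂haarUnitary n +
      1 / 2 * ∫ U, (conjUnitary D U p p).re * (conjUnitary D U q q).re ∂haarUnitary n +
      ∫ U, (conjUnitary D U p q).re ^ 2 ∂haarUnitary n +
      ∫ U, ((conjUnitary D U p p).re + (conjUnitary D U q q).re) *
      (conjUnitary D U p q).re ∂haarUnitary n := by
    rw [← integral_const_mul, ← integral_const_mul, ← integral_const_mul, ← integral_add,
      ← integral_add, ← integral_add, ← integral_add]
    · congr 1; ext U; ring
    all_goals exact integrable_of_continuous _ (by fun_prop)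
  have hn : ∫ U, Complex.normSq (conjUnitary D U p q) ∂haarUnitary n =
      ∫ U, (conjUnitary D U p q).re ^ 2 ∂haarUnitary n +
      ∫ U, (conjUnitary D U p q).im ^ 2 ∂haarUnitary n := by
    rw [← integral_add (integrable_of_continuous _ (by fun_prop))
      (integrable_of_continuous _ (by fun_prop))]
    congr 1; ext U; rw [Complex.normSq_apply]; ring
  have hq := integral_diag_sq_eq (D := D) p q
  rw [hexp, hflip0, hq] at hH
  rw [hn, hI]
  linarith

/-- Second moment of the off-diagonal entries of a randomly rotated traceless observable. -/
theorem integral_normSq_offDiag {D : Matrix n n ℂ} (hD : D.IsHermitian) (hD0 : D.trace = 0)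
    {p q : n} (h : p ≠ q) :
    ((Fintype.card n : ℝ) ^ 2 - 1) *
      ∫ U, Complex.normSq (conjUnitary D U p q) ∂haarUnitary n = hsNorm D ^ 2 := by
  have c : ∀ i j, Continuous fun U : Matrix.unitaryGroup n ℂ => (conjUnitary D U i j).re :=
    fun i j => Complex.continuous_re.comp (continuous_conjUnitary_apply D i j)
  have cn : ∀ i j, Continuous fun U : Matrix.unitaryGroup n ℂ =>
      Complex.normSq (conjUnitary D U i j) :=
    fun i j => Complex.continuous_normSq.comp (continuous_conjUnitary_apply D i j)
  set o := ∫ U, Complex.normSq (conjUnitary D U p q) ∂haarUnitary n with ho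
  set δ := ∫ U, (conjUnitary D U p p).re ^ 2 ∂haarUnitary n with hδ
  have card_erase : ∀ i : n, ((Finset.univ.erase i).card : ℝ) = Fintype.card n - 1 := by
    intro i
    rw [Finset.card_erase_of_mem (Finset.mem_univ i), Finset.card_univ,
      Nat.cast_sub (Fintype.card_pos_iff.mpr ⟨i⟩), Nat.cast_one]
  have hdiag : ∀ i, ∫ U, Complex.normSq (conjUnitary D U i i) ∂haarUnitary n = δ := by
    intro i
    rw [hδ, ← integral_diag_sq_eq p i]
    congr 1; ext U
    have : (conjUnitary D U i i).im = 0 :=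
      Complex.conj_eq_iff_im.mp ((conjUnitary_isHermitian hD U).apply i i)
    rw [Complex.normSq_apply, this]; ring
  have htr : ∀ U : Matrix.unitaryGroup n ℂ, ∑ r, (conjUnitary D U r r).re = 0 := by
    intro U
    have := congrArg Complex.re ((trace_conjUnitary D U).trans hD0)
    rwa [Matrix.trace, Complex.re_sum] at this
  -- Tracelessness gives `δ + (d - 1)(δ - o) = 0`, and the preserved norm gives `d (δ + (d - 1) o) =
  -- ‖D‖₂²`. Eliminating `δ` yields the claim.
  have hO : ∑ r, ∫ U, (conjUnitary D U p p).re * (conjUnitary D U r r).re ∂haarUnitary n = 0 := by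
    rw [← integral_finsetSum _ fun r _ =>
      integrable_of_continuous _ (by have := c p p; have := c r r; fun_prop)]
    simp only [← Finset.mul_sum, htr, mul_zero, integral_zero]
  have hOr : ∀ r ∈ Finset.univ.erase p,
      ∫ U, (conjUnitary D U p p).re * (conjUnitary D U r r).re ∂haarUnitary n = δ - o := by
    intro r hr
    have hr' : p ≠ r := (Finset.ne_of_mem_erase hr).symm
    have := integral_diag_sq_eq_add hD hr'
    rw [integral_normSq_offDiag_eq h hr'] at this
    linarith
  rw [← Finset.add_sum_erase _ _ (Finset.mem_univ p), Finset.sum_congr rfl hOr, Finset.sum_const,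
    nsmul_eq_mul, card_erase] at hO
  simp only [← sq] at hO
  rw [← hδ] at hO
  have hN : ∑ i, ∑ j, ∫ U, Complex.normSq (conjUnitary D U i j) ∂haarUnitary n = hsNorm D ^ 2 := by
    simp only [← integral_finsetSum _ fun j _ => integrable_of_continuous (haarUnitary n) (cn _ j)]
    rw [← integral_finsetSum _ fun i _ => integrable_of_continuous _
      (continuous_finsetSum _ fun j _ => cn i j)]
    simp [sum_normSq_conjUnitary]
  have hrow : ∀ i, ∑ j, ∫ U, Complex.normSq (conjUnitary D U i j) ∂haarUnitary n =
      δ + ((Fintype.card n : ℝ) - 1) * o := by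
    intro i
    rw [← Finset.add_sum_erase _ _ (Finset.mem_univ i), hdiag, Finset.sum_congr rfl fun j hj =>
      integral_normSq_offDiag_eq h (Finset.ne_of_mem_erase hj).symm, Finset.sum_const,
      nsmul_eq_mul, card_erase]
  simp only [hrow, Finset.sum_const, Finset.card_univ, nsmul_eq_mul] at hN
  rw [← hN]
  linear_combination -hO

end SecondMoments

/-- A second-moment lower tail bound (Paley–Zygmund). -/
theorem inv_le_measureReal_ge {Ω : Type*} [TopologicalSpace Ω] [CompactSpace Ω] [T2Space Ω]
    [MeasurableSpace Ω] [BorelSpace Ω] (P : Measure Ω) [IsProbabilityMeasure P] {X : Ω → ℝ}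
    (hX : Continuous X) {t B : ℝ} (ht : 0 < t) (hB : 0 < B) (h1 : 2 * t ≤ ∫ ω, X ω ∂P)
    (h2 : ∫ ω, X ω ^ 2 ∂P ≤ B * t ^ 2) : 1 / B ≤ P.real {ω | t ≤ X ω} := by
  have hS : MeasurableSet {ω | t ≤ X ω} := (isClosed_le continuous_const hX).measurableSet
  -- Where `X ≥ t`, this is AM–GM, i.e. `(X - B t)² ≥ 0`. Integrated, it reads `2 t ≤ t + t / 2 + (B
  -- t / 2) P(X ≥ t)`.
  have pt : ∀ ω, X ω ≤ t + 1 / (2 * B * t) * X ω ^ 2 +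
      B * t / 2 * Set.indicator {ω | t ≤ X ω} (fun _ => (1 : ℝ)) ω := by
    intro ω
    have hp : 0 ≤ 1 / (2 * B * t) * X ω ^ 2 := by positivity
    by_cases h : t ≤ X ω
    · rw [Set.indicator_of_mem (show ω ∈ {ω | t ≤ X ω} from h)]
      have : 0 ≤ 1 / (2 * B * t) * (X ω - B * t) ^ 2 := by positivity
      have e : 1 / (2 * B * t) * (X ω - B * t) ^ 2 =
          1 / (2 * B * t) * X ω ^ 2 - X ω + B * t / 2 := by field_simp; ring
      linarith
    · rw [Set.indicator_of_notMem (show ω ∉ {ω | t ≤ X ω} from h)]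
      push Not at h
      linarith
  have iX := integrable_of_continuous P (f := fun ω => t + 1 / (2 * B * t) * X ω ^ 2) (by fun_prop)
  have iS : Integrable (fun ω => B * t / 2 *
      Set.indicator {ω | t ≤ X ω} (fun _ => (1 : ℝ)) ω) P :=
    ((integrable_const _).indicator hS).const_mul _
  have h := integral_mono (integrable_of_continuous P hX) (iX.add iS) pt
  simp only [Pi.add_apply] at h
  rw [integral_add iX iS, integral_add (integrable_const _)
    (integrable_of_continuous P (by fun_prop)), integral_const_mul, integral_const_mul,
    integral_indicator_const _ hS, integral_const, probReal_univ] at h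
  simp only [smul_eq_mul, mul_one, one_mul] at h
  have h3 : 1 / (2 * B * t) * ∫ ω, X ω ^ 2 ∂P ≤ 1 / (2 * B * t) * (B * t ^ 2) := by gcongr
  have e : 1 / (2 * B * t) * (B * t ^ 2) = t / 2 := by field_simp
  rw [div_le_iff₀ hB]
  have : t * 1 ≤ t * (P.real {ω | t ≤ X ω} * B) := by linarith
  exact le_of_mul_le_mul_left this ht

/-! ### Moments of the norm of the partial trace. -/

section PartialTrace

variable {a b : Type*} [Fintype a] [DecidableEq a] [Fintype b] [DecidableEq b]

theorem compress_apply (U : Matrix.unitaryGroup (a × b) ℂ) (D : Matrix (a × b) (a × b) ℂ)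
    (i j : a) : compress U D i j = ∑ k, conjUnitary D U (i, k) (j, k) := rfl

theorem compress_sub (U : Matrix.unitaryGroup (a × b) ℂ) (X Y : Matrix (a × b) (a × b) ℂ) :
    compress U X - compress U Y = compress U (X - Y) := by
  ext i j
  simp [compress_apply, conjUnitary, Matrix.mul_sub, Matrix.sub_mul]

@[fun_prop]
theorem continuous_compress_apply (D : Matrix (a × b) (a × b) ℂ) (i j : a) :
    Continuous fun U : Matrix.unitaryGroup (a × b) ℂ => compress U D i j := by
  simp only [compress_apply]
  fun_prop

theorem continuous_normSq_compress_apply (D : Matrix (a × b) (a × b) ℂ) (i j : a) :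
    Continuous fun U : Matrix.unitaryGroup (a × b) ℂ => Complex.normSq (compress U D i j) :=
  Complex.continuous_normSq.comp (continuous_compress_apply D i j)

theorem continuous_hsNorm_compress_sq (D : Matrix (a × b) (a × b) ℂ) :
    Continuous fun U : Matrix.unitaryGroup (a × b) ℂ => hsNorm (compress U D) ^ 2 := by
  simp only [hsNorm_sq]
  have := continuous_normSq_compress_apply D
  fun_prop

theorem normSq_sum {ι : Type*} [Fintype ι] (z : ι → ℂ) :
    Complex.normSq (∑ k, z k) = ∑ k, ∑ l, (z k * star (z l)).re := by
  have : (Complex.normSq (∑ k, z k) : ℂ) = ∑ k, ∑ l, z k * star (z l) := by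
    rw [← Complex.mul_conj, map_sum, Finset.sum_mul_sum]
    rfl
  have h := congrArg Complex.re this
  simpa only [Complex.ofReal_re, Complex.re_sum] using h

/-- For `i ≠ j` and `k ≠ l`, the phase `-1` at `(i, k)` flips the `k`-th summand of the partial
trace but not the `l`-th, so cross terms vanish. -/
theorem integral_normSq_compress_offDiag (D : Matrix (a × b) (a × b) ℂ) {i j : a} (h : i ≠ j) :
    ∫ U, Complex.normSq (compress U D i j) ∂haarUnitary (a × b) =
      ∑ k, ∫ U, Complex.normSq (conjUnitary D U (i, k) (j, k)) ∂haarUnitary (a × b) := by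
  have c : ∀ k l, Continuous fun U : Matrix.unitaryGroup (a × b) ℂ =>
      (conjUnitary D U (i, k) (j, k) * star (conjUnitary D U (i, l) (j, l))).re :=
    fun k l => Complex.continuous_re.comp (by fun_prop)
  simp only [compress_apply, normSq_sum]
  rw [integral_finsetSum _ fun k _ => integrable_of_continuous _
      (continuous_finsetSum _ fun l _ => c k l)]
  refine Finset.sum_congr rfl fun k _ => ?_
  rw [integral_finsetSum _ fun l _ => integrable_of_continuous _ (c k l), Finset.sum_eq_single k]
  · congr 1; ext U
    rw [Complex.star_def, Complex.mul_conj, Complex.ofReal_re]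
  · intro l _ hl
    have := integral_mul_left_eq_self (μ := haarUnitary (a × b)) (fun U =>
      (conjUnitary D U (i, k) (j, k) * star (conjUnitary D U (i, l) (j, l))).re)
      (phase (i, k) (-1) (by simp))
    have hji : j ≠ i := h.symm
    simp only [conjUnitary_phase_mul, Prod.mk.injEq, hji, hl, false_and, and_false, if_false,
      if_true, and_self, star_one, one_mul, mul_one, neg_mul, Complex.neg_re, integral_neg] at this
    linarith
  · simp

theorem le_integral_hsNorm_compress_sq {D : Matrix (a × b) (a × b) ℂ} (hD : D.IsHermitian)
    (hD0 : D.trace = 0) (ha : 2 ≤ Fintype.card a) (hb : 1 ≤ Fintype.card b) :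
    hsNorm D ^ 2 / (2 * Fintype.card b) ≤
      ∫ U, hsNorm (compress U D) ^ 2 ∂haarUnitary (a × b) := by
  set α : ℝ := (Fintype.card a : ℝ) with hα
  set β : ℝ := (Fintype.card b : ℝ) with hβ
  have hα2 : 2 ≤ α := by rw [hα]; exact_mod_cast ha
  have hβ1 : 1 ≤ β := by rw [hβ]; exact_mod_cast hb
  have hd : 0 < (α * β) ^ 2 - 1 := by
    have : 2 * 1 ≤ α * β := mul_le_mul hα2 hβ1 zero_le_one (by linarith)
    nlinarith
  have off : ∀ i j, i ≠ j → ∫ U, Complex.normSq (compress U D i j) ∂haarUnitary (a × b) =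
      β * (hsNorm D ^ 2 / ((α * β) ^ 2 - 1)) := by
    intro i j h
    rw [integral_normSq_compress_offDiag D h, Finset.sum_congr rfl (fun k _ => ?_),
      Finset.sum_const, Finset.card_univ, nsmul_eq_mul]
    have hne : ((i, k) : a × b) ≠ (j, k) := fun e => h (congrArg Prod.fst e)
    have := integral_normSq_offDiag hD hD0 hne
    rw [Fintype.card_prod, Nat.cast_mul] at this
    rw [eq_div_iff hd.ne', mul_comm]
    exact this
  simp only [hsNorm_sq (compress _ D)]
  have cN := continuous_normSq_compress_apply D
  rw [integral_finsetSum _ fun i _ => integrable_of_continuous _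
      (continuous_finsetSum _ fun j _ => cN i j)]
  have row : ∀ i, (α - 1) * (β * (hsNorm D ^ 2 / ((α * β) ^ 2 - 1))) ≤
      ∫ U, ∑ j, Complex.normSq (compress U D i j) ∂haarUnitary (a × b) := by
    intro i
    rw [integral_finsetSum _ fun j _ => integrable_of_continuous _ (cN i j),
      ← Finset.add_sum_erase _ _ (Finset.mem_univ i), Finset.sum_congr rfl fun j hj =>
      off i j (Finset.ne_of_mem_erase hj).symm, Finset.sum_const, nsmul_eq_mul,
      Finset.card_erase_of_mem (Finset.mem_univ i), Finset.card_univ,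
      Nat.cast_sub (by omega), Nat.cast_one]
    exact le_add_of_nonneg_left (integral_nonneg fun U => Complex.normSq_nonneg _)
  refine le_trans ?_ (Finset.sum_le_sum fun i _ => row i)
  rw [Finset.sum_const, Finset.card_univ, nsmul_eq_mul, ← hα]
  have e : α * ((α - 1) * (β * (hsNorm D ^ 2 / ((α * β) ^ 2 - 1)))) =
      hsNorm D ^ 2 * (α * (α - 1) * β) / ((α * β) ^ 2 - 1) := by ring
  rw [e, div_le_div_iff₀ (by positivity) hd]
  -- This is where `d_A ≥ 2` matters: it gives `2 (α - 1) ≥ α`, so discarding the diagonal loses at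
  -- most a factor 2.
  have key : (α * β) ^ 2 - 1 ≤ α * (α - 1) * β * (2 * β) := by
    nlinarith [mul_nonneg (mul_nonneg (by linarith : 0 ≤ α) (by linarith : 0 ≤ α - 2))
      (sq_nonneg β)]
  rw [mul_assoc (hsNorm D ^ 2)]
  exact mul_le_mul_of_nonneg_left key (sq_nonneg _)

theorem exists_trace_conjUnitary_mul_eq_compress (D : Matrix (a × b) (a × b) ℂ) (i j : a) :
    ∃ G : Matrix (a × b) (a × b) ℂ, hsNorm G ^ 2 = Fintype.card b ∧
      ∀ U, compress U D i j = (conjUnitary D U * G).trace := by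
  -- The witness is `|j⟩⟨i| ⊗ 1_B`.
  refine ⟨Matrix.of fun x y => if x.1 = j ∧ y.1 = i ∧ x.2 = y.2 then 1 else 0, ?_, fun U => ?_⟩
  · rw [hsNorm_sq]
    simp only [Matrix.of_apply, Fintype.sum_prod_type, apply_ite Complex.normSq, map_one, map_zero,
      ite_and]
    simp
  · rw [compress_apply, Matrix.trace]
    simp only [Matrix.diag_apply, Matrix.mul_apply, Matrix.of_apply, Fintype.sum_prod_type, ite_and]
    simp

theorem integral_hsNorm_compress_pow_four_le {D : Matrix (a × b) (a × b) ℂ} (hD : D.IsHermitian)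
    (hD0 : D.trace = 0) (ha : 1 ≤ Fintype.card a) (hb : 1 ≤ Fintype.card b) :
    ∫ U, (hsNorm (compress U D) ^ 2) ^ 2 ∂haarUnitary (a × b) ≤
      4 * (576 ^ 2 * 4096) * (hsNorm D ^ 2 / Fintype.card b) ^ 2 := by
  set α : ℝ := (Fintype.card a : ℝ) with hα
  set β : ℝ := (Fintype.card b : ℝ) with hβ
  have hα1 : 0 < α := by rw [hα]; exact_mod_cast ha
  have hβ1 : 0 < β := by rw [hβ]; exact_mod_cast hb
  have cN := continuous_normSq_compress_apply D
  have entry : ∀ x : a × a, ∫ U, Complex.normSq (compress U D x.1 x.2) ^ 2 ∂haarUnitary (a × b) ≤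
      4 * (576 ^ 2 * 4096) * (hsNorm D ^ 2 * β) ^ 2 / (α * β) ^ 4 := by
    intro x
    obtain ⟨G, hG, hU⟩ := exists_trace_conjUnitary_mul_eq_compress D x.1 x.2
    have := integral_normSq_trace_sq_le hD hD0 G
    rw [hG, Fintype.card_prod, Nat.cast_mul] at this
    simpa only [hU] using this
  -- Cauchy–Schwarz over the `α²` entries loses nothing in order of magnitude: `α² · α² · β² / (α
  -- β)⁴ = 1 / β²`.
  have pt : ∀ U : Matrix.unitaryGroup (a × b) ℂ, (hsNorm (compress U D) ^ 2) ^ 2 ≤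
      α ^ 2 * ∑ x : a × a, Complex.normSq (compress U D x.1 x.2) ^ 2 := by
    intro U
    rw [hsNorm_sq, ← Fintype.sum_prod_type' fun i j => Complex.normSq (compress U D i j)]
    have := sq_sum_le_card_mul_sum_sq (s := Finset.univ)
      (f := fun x : a × a => Complex.normSq (compress U D x.1 x.2))
    rwa [Finset.card_univ, Fintype.card_prod, Nat.cast_mul, ← sq] at this
  have cS := continuous_hsNorm_compress_sq D
  calc _ ≤ ∫ U, α ^ 2 * ∑ x : a × a, Complex.normSq (compress U D x.1 x.2) ^ 2
        ∂haarUnitary (a × b) :=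
        integral_mono (integrable_of_continuous _ (by fun_prop))
          (integrable_of_continuous _ (by fun_prop)) pt
    _ = α ^ 2 * ∑ x : a × a, ∫ U, Complex.normSq (compress U D x.1 x.2) ^ 2
        ∂haarUnitary (a × b) := by
        rw [integral_const_mul, integral_finsetSum _ fun x _ => integrable_of_continuous _
          ((cN x.1 x.2).pow 2)]
    _ ≤ α ^ 2 * ∑ x : a × a, 4 * (576 ^ 2 * 4096) * (hsNorm D ^ 2 * β) ^ 2 / (α * β) ^ 4 := by
        gcongr with x
        exact entry x
    _ = _ := by
        rw [Finset.sum_const, Finset.card_univ, Fintype.card_prod, nsmul_eq_mul, Nat.cast_mul, ← hα]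
        field_simp

end PartialTrace

end QCompress

end

/-! ### Conclusion by Paley–Zygmund. -/

theorem mainTheorem2 :
    ∃ C₂ : ℝ, 1 < C₂ ∧
      ∀ d dA dB : ℕ, 2 ≤ dA → 1 ≤ dB → d = dA * dB →
        ∀ ρ σ : Matrix (Fin dA × Fin dB) (Fin dA × Fin dB) ℂ,
          QCompress.IsState ρ → QCompress.IsState σ →
            1 / C₂ ≤ (QCompress.haarUnitary (Fin dA × Fin dB)).real
              {U | (1 / 2 : ℝ) * Real.sqrt ((dA : ℝ) / (d : ℝ)) * QCompress.hsNorm (ρ - σ) ≤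
                QCompress.hsNorm (QCompress.compress U ρ - QCompress.compress U σ)} := by
  -- With `t = ‖D‖₂² / (4 d_B)`, the second-moment bound is `4 (576² · 4096) (4 t)²`, and `4 · 4² =
  -- 64`.
  refine ⟨64 * (576 ^ 2 * 4096), by norm_num, ?_⟩
  intro d dA dB hA hB hd ρ σ hρ hσ
  simp only [QCompress.compress_sub]
  have hD : (ρ - σ).IsHermitian := hρ.1.isHermitian.sub hσ.1.isHermitian
  have hD0 : (ρ - σ).trace = 0 := by rw [Matrix.trace_sub, hρ.2, hσ.2, sub_self]
  generalize ρ - σ = D at hD hD0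
  have hA' : (0 : ℝ) < dA := by exact_mod_cast (by omega : 0 < dA)
  have hB' : (0 : ℝ) < dB := by exact_mod_cast (by omega : 0 < dB)
  have hnn : ∀ {m : Type} [Fintype m] (M : Matrix m m ℂ), 0 ≤ QCompress.hsNorm M :=
    fun M => Real.sqrt_nonneg _
  have hset : {U | (1 / 2 : ℝ) * Real.sqrt ((dA : ℝ) / (d : ℝ)) * QCompress.hsNorm D ≤
      QCompress.hsNorm (QCompress.compress U D)} =
      {U | QCompress.hsNorm D ^ 2 / (4 * dB) ≤ QCompress.hsNorm (QCompress.compress U D) ^ 2} := by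
    ext U
    rw [Set.mem_ofPred_eq, Set.mem_ofPred_eq, ← pow_le_pow_iff_left₀
      (mul_nonneg (by positivity) (hnn D)) (hnn _) two_ne_zero, mul_pow, mul_pow,
      Real.sq_sqrt (by positivity), hd, Nat.cast_mul]
    have : (1 / 2 : ℝ) ^ 2 * (dA / (dA * dB)) * QCompress.hsNorm D ^ 2 =
        QCompress.hsNorm D ^ 2 / (4 * dB) := by field_simp; ring
    rw [this]
  rw [hset]
  -- The Paley–Zygmund bound needs `t > 0`; if `‖D‖₂ = 0` the event is the whole group.
  rcases (hnn D).eq_or_lt with h0 | hpos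
  · have : {U | QCompress.hsNorm D ^ 2 / (4 * dB) ≤
        QCompress.hsNorm (QCompress.compress U D) ^ 2} = Set.univ := by
      ext U
      simp only [← h0, Set.mem_ofPred_eq, Set.mem_univ, iff_true]
      simpa using sq_nonneg _
    rw [this, MeasureTheory.probReal_univ]
    norm_num
  · have h1 := QCompress.le_integral_hsNorm_compress_sq hD hD0 (by simpa using hA) (by simpa using hB)
    have h2 := QCompress.integral_hsNorm_compress_pow_four_le hD hD0 (by simp; omega)
      (by simpa using hB)
    rw [Fintype.card_fin] at h1 h2
    refine QCompress.inv_le_measureReal_ge _ (QCompress.continuous_hsNorm_compress_sq D)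
      (by positivity) (by norm_num) (le_trans (le_of_eq ?_) h1) (h2.trans (le_of_eq ?_))
    · field_simp; norm_num
    · field_simp; norm_num
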